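/- Let $M\in\mathbb Z^{m\times n}$ and $b\in\mathbb Z^m$ be such that the polyhedron $Q:=\{x\in\mathbb R^n: Mx\le b\}$ is nonempty, and let $\mathbb L\subseteq\mathbb R$ be a heavy set, i.e. a dense subset of $\mathbb R$ that contains $\mathbb Z$ and is a subgroup of $(\mathbb R,+)$. Notation. A vector $w\in\mathbb R^n$ is admissible if the linear program $\max\{w^\top x: Mx\le b\}$ has an optimal solution (equivalently, by strong duality, if its dual $\min\{b^\top y: M^\top y=w,\ y\ge \mathbf 0\}$ has one). The system $Mx\le b$ is totally dual in $\mathbb L$ if for every admissible $w\in\mathbb L^n$ the dual program $\min\{b^\top y: M^\top y=w,\ y\ge\mathbf 0\}$ has an optimal solution in $\mathbb L^m$. For $S\subseteq\mathbb R^n$ let $I(S)$ be the set of indices $i\in\{1,\dots,m\}$ with $\mathrm{row}_i(M)x=b_i$ for all $x\in S$, and let $M^=$ be the matrix formed by the rows of $M$ with index in $I(Q)$ (the implicit equalities). Finitely many vectors of $\mathbb Z^n$ form an $\mathbb L$-generating set for a cone if every vector of $\mathbb L^n$ that is a conic (i.e. nonnegative real linear) combination of them is a conic combination of them with multipliers in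 $\mathbb L$; the only conic combination of the empty family is $\mathbf 0$. A face of $Q$ is a set $Q\cap\{x: c^\top x=\delta\}$ with $c^\top x\le\delta$ for all $x\in Q$ (so $Q$ is a face of itself). For faces $F,F^+$ of $Q$ with $F\neq\emptyset$, $F^+$ is a down-face of $F$ if $F\subsetneq F^+$ and $\dim F^+=\dim F+1$, where $\dim$ is the dimension of the affine hull $\mathrm{aff}$. If $w$ is admissible, $\tau$ is the optimal value of $\max\{w^\top x: Mx\le b\}$, $F$ is its set of optimal solutions and $F^+$ is a down-face of $F$, then the $(w,F,F^+)$-tilt constraint is the linear equation $$\frac{1}{\tau-w^\top\rho}\sum_{i\in I(F)\setminus I(F^+)}\bigl[b_i-\mathrm{row}_i(M)\rho\bigr]\,u_i=1$$ in the variables $u_i$, $i\in I(F)\setminus I(F^+)$, where $\rho\in\mathrm{aff}(F^+)\setminus\mathrm{aff}(F)$; the equation does not depend on the choice of $\rho$. Theorem. The system $Mx\le b$ is totally dual in $\mathbb L$ if and only if both of the following conditions hold: (i) the rows of $M^=$ form an $\mathbb L$-generating set for a cone; (ii) for every admissible $w\in\mathbb L^n$, with $F$ the set of optimal solutions of $\max\{w^\top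 x: Mx\le b\}$, and for every down-face $F^+$ of $F$, the $(w,F,F^+)$-tilt constraint has a solution with all $u_i$, $i\in I(F)\setminus I(F^+)$, in $\mathbb L$. -/

import Mathlib

open scoped Matrix

noncomputable section

namespace TotalDual

/-- A heavy set: a dense subset of `ℝ` that contains all integers and is a subgroup of `(ℝ, +)`. -/
structure IsHeavy (L : Set ℝ) : Prop where
  dense : Dense L
  int_mem : ∀ z : ℤ, (z : ℝ) ∈ L
  subgroup : ∃ G : AddSubgroup ℝ, (G : Set ℝ) = L

variable {m n : ℕ}

/-- The integer matrix `M`, read as a real matrix. -/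
def realMat (M : Matrix (Fin m) (Fin n) ℤ) : Matrix (Fin m) (Fin n) ℝ :=
  M.map (fun z : ℤ => (z : ℝ))

/-- The polyhedron `Q = {x ∈ ℝⁿ : M x ≤ b}`. -/
def polyhedron (M : Matrix (Fin m) (Fin n) ℤ) (b : Fin m → ℤ) : Set (Fin n → ℝ) :=
  {x | ∀ i, (realMat M *ᵥ x) i ≤ (b i : ℝ)}

/-- The optimal solutions of the primal program `max {wᵀx : M x ≤ b}`. -/
def primalOpt (M : Matrix (Fin m) (Fin n) ℤ) (b : Fin m → ℤ) (w : Fin n → ℝ) :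
    Set (Fin n → ℝ) :=
  {x | x ∈ polyhedron M b ∧ ∀ z ∈ polyhedron M b, w ⬝ᵥ z ≤ w ⬝ᵥ x}

/-- `τ` is the (attained) optimal value of the primal program `max {wᵀx : M x ≤ b}`. -/
def IsPrimalValue (M : Matrix (Fin m) (Fin n) ℤ) (b : Fin m → ℤ) (w : Fin n → ℝ) (τ : ℝ) :
    Prop :=
  IsGreatest ((fun x : Fin n → ℝ => w ⬝ᵥ x) '' polyhedron M b) τ

/-- The feasible solutions of the dual program `min {bᵀy : Mᵀy = w, y ≥ 0}`. -/
def dualFeasible (M : Matrix (Fin m) (Fin n) ℤ) (w : Fin n → ℝ) : Set (Fin m → ℝ) :=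
  {y | (realMat M)ᵀ *ᵥ y = w ∧ ∀ i, 0 ≤ y i}

/-- The optimal solutions of the dual program `min {bᵀy : Mᵀy = w, y ≥ 0}`. -/
def dualOpt (M : Matrix (Fin m) (Fin n) ℤ) (b : Fin m → ℤ) (w : Fin n → ℝ) :
    Set (Fin m → ℝ) :=
  {y | y ∈ dualFeasible M w ∧
    ∀ z ∈ dualFeasible M w, (fun i => (b i : ℝ)) ⬝ᵥ y ≤ (fun i => (b i : ℝ)) ⬝ᵥ z}

/-- `w` is admissible: the primal program has an optimal solution. By strong duality this is the
same as the dual program having one; that fact is not built into the definition. -/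
def Admissible (M : Matrix (Fin m) (Fin n) ℤ) (b : Fin m → ℤ) (w : Fin n → ℝ) : Prop :=
  (primalOpt M b w).Nonempty

/-- `M x ≤ b` is totally dual in `L`: for every admissible `w ∈ Lⁿ` the dual program has an optimal
solution in `Lᵐ`. -/
def IsTotallyDual (L : Set ℝ) (M : Matrix (Fin m) (Fin n) ℤ) (b : Fin m → ℤ) : Prop :=
  ∀ w : Fin n → ℝ, (∀ j, w j ∈ L) → Admissible M b w →
    ∃ y ∈ dualOpt M b w, ∀ i, y i ∈ L

open Classical in
/-- The index set `I(S)` of the constraints of `M x ≤ b` that are tight at every point of `S`. -/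
def tightRows (M : Matrix (Fin m) (Fin n) ℤ) (b : Fin m → ℤ) (S : Set (Fin n → ℝ)) :
    Finset (Fin m) :=
  Finset.univ.filter (fun i => ∀ x ∈ S, (realMat M *ᵥ x) i = (b i : ℝ))

/-- The matrix `M⁼` of the implicit equalities of `M x ≤ b`: the rows of the constraints that are
tight for the whole polyhedron. -/
def implicitEqMatrix (M : Matrix (Fin m) (Fin n) ℤ) (b : Fin m → ℤ) :
    Matrix {i : Fin m // i ∈ tightRows M b (polyhedron M b)} (Fin n) ℤ :=
  M.submatrix (fun i => i.1) id

/-- The rows of `A` form an `L`-generating set for a cone: every vector of `Lⁿ` that is a conic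
combination of the rows of `A` is a conic combination of these rows with multipliers in `L`. -/
def RowsFormGSC {ι : Type*} [Fintype ι] (L : Set ℝ) (A : Matrix ι (Fin n) ℤ) : Prop :=
  ∀ v : Fin n → ℝ, (∀ j, v j ∈ L) →
    (∃ c : ι → ℝ, (∀ i, 0 ≤ c i) ∧ v = ∑ i, c i • (fun j => (A i j : ℝ))) →
    ∃ c : ι → ℝ, (∀ i, 0 ≤ c i) ∧ (∀ i, c i ∈ L) ∧ v = ∑ i, c i • (fun j => (A i j : ℝ))

/-- The dimension of a nonempty set: the dimension of its affine hull. -/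
def dim (S : Set (Fin n → ℝ)) : ℕ :=
  Module.finrank ℝ (affineSpan ℝ S).direction

/-- For faces `F`, `F'` of a polyhedron `Q`, with `F` nonempty: `F'` is a down-face of `F`, that is,
`F ⊂ F'` and `dim F' = dim F + 1`. A face of `Q` is the set of maximizers over `Q` of a linear
functional; `Q` itself is a face. -/
def IsDownFace (Q F F' : Set (Fin n → ℝ)) : Prop :=
  F.Nonempty ∧ IsExposed ℝ Q F ∧ IsExposed ℝ Q F' ∧ F ⊂ F' ∧ dim F' = dim F + 1

/-- `u` solves the `(w, F, F')`-tilt constraint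
`1 / (τ - wᵀρ) * ∑_{i ∈ I(F) \ I(F')} (b_i - row_i(M) ρ) u_i = 1`, where `ρ` is a point of
`aff F' \ aff F`. For a nonempty face `F` cut out by the supporting hyperplane `wᵀx = τ` and a
down-face `F'` of `F`, such points `ρ` exist, `τ - wᵀρ` is not zero, and the constraint is the same
for all of them. Only the entries `u i` with `i ∈ I(F) \ I(F')` matter. -/
def IsTiltSolution (M : Matrix (Fin m) (Fin n) ℤ) (b : Fin m → ℤ) (w : Fin n → ℝ) (τ : ℝ)
    (F F' : Set (Fin n → ℝ)) (u : Fin m → ℝ) : Prop :=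
  ∀ ρ : Fin n → ℝ, ρ ∈ affineSpan ℝ F' → ρ ∉ affineSpan ℝ F →
    1 / (τ - w ⬝ᵥ ρ) *
      ∑ i ∈ tightRows M b F \ tightRows M b F', ((b i : ℝ) - (realMat M *ᵥ ρ) i) * u i = 1

/-- The `(w, F, F')`-tilt constraint has a solution with all variables
`u_i`, `i ∈ I(F) \ I(F')`, in `L`. -/
def TiltSolvableIn (L : Set ℝ) (M : Matrix (Fin m) (Fin n) ℤ) (b : Fin m → ℤ) (w : Fin n → ℝ)
    (τ : ℝ) (F F' : Set (Fin n → ℝ)) : Prop :=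
  ∃ u : Fin m → ℝ, (∀ i ∈ tightRows M b F \ tightRows M b F', u i ∈ L) ∧
    IsTiltSolution M b w τ F F' u

end TotalDual

end

namespace TotalDual

variable {m n : ℕ}

/-! Let F be the optimal face of an admissible w. By complementary slackness the optimal dual
solutions are exactly the nonnegative y supported on I(F) with Mᵀy = w. Necessity: such a y over L
solves every tilt constraint, because τ - wᵀρ = ∑ yᵢ(bᵢ - rowᵢρ) and the terms of I(F⁺) vanish on
aff F⁺; objectives with F = Q give condition (i). Sufficiency splits in two. Signs are harmless:
strict complementarity (`Admissible.exists_strict_dual`) yields a real solution positive on I(F),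
and density of L carries any L-solution supported on I(F) close to it
(`IsHeavy.exists_pos_solution`). An L-solution of arbitrary sign comes from induction on |I(F)|
(`exists_combination_of_tilt`): subtracting Mᵀu, with u a tilt solution for a down-face F⁺, leaves a
functional constant on F⁺; a large integer multiple of the rows of I(F⁺) then makes F⁺ its optimal
face. The induction ends at F = Q, which is condition (i). -/

/-! ### Farkas' lemma -/

/-- **Farkas' lemma** for finitely many vectors. -/
theorem farkas {ι : Type*} (s : Finset ι) (a : ι → Fin n → ℝ) (c : Fin n → ℝ)
    (h : ∀ x, (∀ i ∈ s, a i ⬝ᵥ x ≤ 0) → c ⬝ᵥ x ≤ 0) :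
    ∃ y : ι → ℝ, (∀ i, 0 ≤ y i) ∧ (∀ i ∉ s, y i = 0) ∧ c = ∑ i ∈ s, y i • a i := by
  classical
  induction s using Finset.induction_on generalizing a c with
  | empty =>
    refine ⟨0, fun _ => le_rfl, fun _ _ => rfl, ?_⟩
    have h0 := h c (by simp)
    have h1 : c ⬝ᵥ c = 0 :=
      le_antisymm h0 (Finset.sum_nonneg fun i _ => mul_self_nonneg (c i))
    simpa using dotProduct_self_eq_zero.mp h1
  | insert k s hk ih =>
    by_cases hc : ∀ x, (∀ i ∈ s, a i ⬝ᵥ x ≤ 0) → c ⬝ᵥ x ≤ 0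
    · obtain ⟨y, hy0, hys, hy⟩ := ih a c hc
      refine ⟨y, hy0, fun i hi => hys i fun h' => hi (Finset.mem_insert_of_mem h'), ?_⟩
      rw [Finset.sum_insert hk, hys k hk, zero_smul, zero_add, hy]
    · push Not at hc
      obtain ⟨x, hx, hcx⟩ := hc
      have hkx : 0 < a k ⬝ᵥ x := by
        by_contra! hle
        refine absurd (h x fun i hi => ?_) (not_le.mpr hcx)
        rcases Finset.mem_insert.mp hi with rfl | hi
        exacts [hle, hx i hi]
      set t := a k ⬝ᵥ x with ht
      -- Each vector is made orthogonal to x by subtracting a multiple of `a k`. Pairing the result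
      -- with z is pairing the original with z - (a k ⬝ᵥ z / t) x, a point of the hyperplane
      -- orthogonal to `a k`, where `h` applies.
      obtain ⟨y, hy0, hys, hy⟩ := ih (fun i => a i - ((a i ⬝ᵥ x) / t) • a k)
        (c - ((c ⬝ᵥ x) / t) • a k) (by
          intro z hz
          have := h (z - ((a k ⬝ᵥ z) / t) • x) (by
            intro i hi
            rcases Finset.mem_insert.mp hi with rfl | hi
            · simp only [dotProduct_sub, dotProduct_smul, smul_eq_mul, ← ht]
              field_simp
              simp
            · have := hz i hi
              simp only [dotProduct_sub, dotProduct_smul, sub_dotProduct, smul_dotProduct,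
                smul_eq_mul] at this ⊢
              calc _ = _ := by ring
                _ ≤ 0 := this)
          simp only [dotProduct_sub, dotProduct_smul, sub_dotProduct, smul_dotProduct,
                smul_eq_mul] at this ⊢
          calc _ = _ := by ring
            _ ≤ 0 := this)
      -- The coefficient of `a k` collects the subtracted multiples; it is nonnegative because a i
      -- ⬝ᵥ x ≤ 0 < c ⬝ᵥ x.
      refine ⟨Function.update y k ((c ⬝ᵥ x) / t - ∑ i ∈ s, y i * ((a i ⬝ᵥ x) / t)),
        fun i => ?_, fun i hi => ?_, ?_⟩
      · rcases eq_or_ne i k with rfl | hik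
        · rw [Function.update_self]
          have : ∑ i ∈ s, y i * ((a i ⬝ᵥ x) / t) ≤ 0 :=
            Finset.sum_nonpos fun i hi => mul_nonpos_of_nonneg_of_nonpos (hy0 i)
              (div_nonpos_of_nonpos_of_nonneg (hx i hi) hkx.le)
          have := div_pos hcx hkx
          linarith
        · rw [Function.update_of_ne hik]
          exact hy0 i
      · rw [Finset.mem_insert, not_or] at hi
        rw [Function.update_of_ne hi.1]
        exact hys i hi.2
      · rw [Finset.sum_insert hk, Function.update_self]
        have hu : ∀ q, ∑ i ∈ s, Function.update y k q i • a i = ∑ i ∈ s, y i • a i := fun q =>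
          Finset.sum_congr rfl fun i hi => by
            rw [Function.update_of_ne (ne_of_mem_of_not_mem hi hk)]
        rw [hu]
        have hc' : c = (∑ i ∈ s, y i • (a i - ((a i ⬝ᵥ x) / t) • a k))
            + ((c ⬝ᵥ x) / t) • a k := by rw [← hy]; abel
        refine hc'.trans ?_
        simp only [smul_sub, Finset.sum_sub_distrib, smul_smul, ← Finset.sum_smul, sub_smul]
        abel

/-! ### Integer systems over a heavy group -/

/-- A real vector in the kernel of an integer matrix is a real combination of integer vectors in
the kernel. -/
theorem exists_integer_kernel_decomposition {ι κ : Type*} [Fintype ι]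
    (A : κ → ι → ℤ) (r : ι → ℝ) (hr : ∀ j, ∑ i, (A j i : ℝ) * r i = 0) :
    ∃ (p : ℕ) (e : Fin p → ℝ) (z : ι → Fin p → ℤ),
      (∀ i, r i = ∑ k, (z i k : ℝ) * e k) ∧ ∀ j k, ∑ i, A j i * z i k = 0 := by
  -- The group generated by the entries of r is finitely generated and torsion-free, hence free. An
  -- integer relation among the entries holds in each coordinate of a ℤ-basis.
  let S : Submodule ℤ ℝ := Submodule.span ℤ (Set.range r)
  have : Module.Finite ℤ S := Module.Finite.span_of_finite ℤ (Set.finite_range r)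
  have : Module.Free ℤ S := Module.free_of_finite_type_torsion_free'
  let B := Module.finBasis ℤ S
  let r' : ι → S := fun i => ⟨r i, Submodule.subset_span ⟨i, rfl⟩⟩
  refine ⟨_, fun k => (B k : ℝ), fun i k => B.repr (r' i) k, fun i => ?_, fun j k => ?_⟩
  · calc r i = ((∑ q, B.repr (r' i) q • B q : S) : ℝ) := by rw [B.sum_repr]
      _ = ∑ q, (B.repr (r' i) q : ℝ) * B q := by
        rw [AddSubmonoidClass.coe_finsetSum]
        exact Finset.sum_congr rfl fun q _ => by rw [Submodule.coe_smul, zsmul_eq_mul]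
  · have h0 : ∑ i, A j i • r' i = 0 := by
      apply Subtype.ext
      simpa [r'] using hr j
    have := congrArg (fun v => B.repr v k) h0
    simpa using this

/-- If an integer linear system has a solution over `L` and a positive real solution, then it has a
positive solution over `L`. -/
theorem IsHeavy.exists_pos_solution {L : Set ℝ} (hL : IsHeavy L) {ι κ : Type*} [Fintype ι]
    (A : κ → ι → ℤ) (s : Finset ι) (y z : ι → ℝ) (hy : ∀ i, y i ∈ L) (hys : ∀ i ∉ s, y i = 0)
    (hz : ∀ i ∈ s, 0 < z i) (hzs : ∀ i ∉ s, z i = 0)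
    (h : ∀ j, ∑ i, (A j i : ℝ) * y i = ∑ i, (A j i : ℝ) * z i) :
    ∃ v : ι → ℝ, (∀ i, v i ∈ L) ∧ (∀ i ∈ s, 0 < v i) ∧ (∀ i ∉ s, v i = 0) ∧
      ∀ j, ∑ i, (A j i : ℝ) * v i = ∑ i, (A j i : ℝ) * z i := by
  classical
  obtain ⟨G, rfl⟩ := hL.subgroup
  -- The unit rows appended to `A` force the integer kernel vectors to be supported on s.
  obtain ⟨p, e, k, hk, hAk⟩ := exists_integer_kernel_decomposition
    (Sum.elim A fun l : {i // i ∉ s} => Pi.single l.1 1) (fun i => z i - y i) (by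
      rintro (j | l)
      · simp [mul_sub, h j]
      · simp [Pi.single_apply, hys l.1 l.2, hzs l.1 l.2])
  have hks : ∀ i ∉ s, ∀ q, k i q = 0 := fun i hi q => by
    simpa [Pi.single_apply] using hAk (Sum.inr ⟨i, hi⟩) q
  -- The parameter e gives back z, so positivity on s persists near e, where density supplies a
  -- parameter over L.
  have hopen : IsOpen {t : Fin p → ℝ | ∀ i ∈ s, 0 < y i + ∑ q, (k i q : ℝ) * t q} := by
    simp only [Set.ofPred_forall]
    exact isOpen_biInter_finset fun i _ => isOpen_lt continuous_const (by fun_prop)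
  obtain ⟨t, ht, htL⟩ := (dense_pi Set.univ (s := fun _ : Fin p => (G : Set ℝ))
    fun _ _ => hL.dense).inter_open_nonempty _ hopen
      ⟨e, fun i hi => by rw [← hk i]; simpa using hz i hi⟩
  refine ⟨fun i => y i + ∑ q, (k i q : ℝ) * t q, fun i => ?_, ht, fun i hi => ?_, fun j => ?_⟩
  · refine G.add_mem (hy i) (G.sum_mem fun q _ => ?_)
    rw [← zsmul_eq_mul]
    exact G.zsmul_mem (htL q trivial) _
  · simp [hys i hi, hks i hi]
  · rw [← h j]
    simp only [mul_add, Finset.sum_add_distrib, Finset.mul_sum, add_eq_left]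
    rw [Finset.sum_comm]
    refine Finset.sum_eq_zero fun q _ => ?_
    have : ∑ i, (A j i : ℝ) * (k i q : ℝ) = 0 := by exact_mod_cast hAk (Sum.inl j) q
    simp only [← mul_assoc, ← Finset.sum_mul, this, zero_mul]

/-! ### Faces and points with slack -/

variable {M : Matrix (Fin m) (Fin n) ℤ} {b : Fin m → ℤ} {w : Fin n → ℝ} {L : Set ℝ}

/-- The points of the polyhedron at which all constraints in `I` are tight. -/
def face (M : Matrix (Fin m) (Fin n) ℤ) (b : Fin m → ℤ) (I : Finset (Fin m)) :
    Set (Fin n → ℝ) :=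
  {x | x ∈ polyhedron M b ∧ ∀ i ∈ I, (realMat M *ᵥ x) i = (b i : ℝ)}

/-- The kernel of the submatrix of `M` with rows in `I`. -/
def rowKer (M : Matrix (Fin m) (Fin n) ℤ) (I : Finset (Fin m)) : Submodule ℝ (Fin n → ℝ) where
  carrier := {d | ∀ i ∈ I, (realMat M *ᵥ d) i = 0}
  add_mem' hx hy i hi := by simp [Matrix.mulVec_add, hx i hi, hy i hi]
  zero_mem' i _ := by simp
  smul_mem' c x hx i hi := by simp [Matrix.mulVec_smul, hx i hi]

theorem mem_tightRows {S : Set (Fin n → ℝ)} {i : Fin m} :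
    i ∈ tightRows M b S ↔ ∀ x ∈ S, (realMat M *ᵥ x) i = (b i : ℝ) := by
  simp [tightRows]

theorem transpose_mulVec_dotProduct (y : Fin m → ℝ) (x : Fin n → ℝ) :
    ((realMat M)ᵀ *ᵥ y) ⬝ᵥ x = ∑ i, y i * (realMat M *ᵥ x) i := by
  rw [Matrix.mulVec_transpose, ← Matrix.dotProduct_mulVec]
  rfl

theorem transpose_mulVec_apply (y : Fin m → ℝ) (j : Fin n) :
    ((realMat M)ᵀ *ᵥ y) j = ∑ i, (M i j : ℝ) * y i := rfl

theorem transpose_mulVec_eq_sum_rows {I : Finset (Fin m)} {y : Fin m → ℝ}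
    (hy : ∀ i ∉ I, y i = 0) : (realMat M)ᵀ *ᵥ y = ∑ i ∈ I, y i • realMat M i := by
  rw [Finset.sum_subset (Finset.subset_univ I) fun i _ hi => by rw [hy i hi, zero_smul]]
  ext j
  rw [transpose_mulVec_apply]
  simp [realMat, mul_comm]

theorem convex_polyhedron : Convex ℝ (polyhedron M b) := by
  intro x hx y hy s t hs ht hst i
  simp only [Matrix.mulVec_add, Matrix.mulVec_smul, Pi.add_apply, Pi.smul_apply, smul_eq_mul]
  calc _ ≤ s * b i + t * b i :=
        add_le_add (mul_le_mul_of_nonneg_left (hx i) hs) (mul_le_mul_of_nonneg_left (hy i) ht)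
    _ = b i := by rw [← add_mul, hst, one_mul]

theorem convex_primalOpt : Convex ℝ (primalOpt M b w) := by
  intro x hx y hy s t hs ht hst
  refine ⟨convex_polyhedron hx.1 hy.1 hs ht hst, fun z hz => ?_⟩
  simp only [dotProduct_add, dotProduct_smul, smul_eq_mul]
  calc w ⬝ᵥ z = s * (w ⬝ᵥ z) + t * (w ⬝ᵥ z) := by rw [← add_mul, hst, one_mul]
    _ ≤ _ := add_le_add (mul_le_mul_of_nonneg_left (hx.2 z hz) hs)
        (mul_le_mul_of_nonneg_left (hy.2 z hz) ht)

/-- Each row outside `tightRows M b S` has slack at some point of S; successive midpoints keep all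
slack gained so far. -/
theorem exists_strict_of_convex {S : Set (Fin n → ℝ)} (hS : Convex ℝ S)
    (hSQ : S ⊆ polyhedron M b) (hne : S.Nonempty) :
    ∃ x ∈ S, ∀ i ∉ tightRows M b S, (realMat M *ᵥ x) i < b i := by
  classical
  suffices H : ∀ J : Finset (Fin m), ∃ x ∈ S, ∀ i ∈ J, i ∉ tightRows M b S →
      (realMat M *ᵥ x) i < b i by
    obtain ⟨x, hx, h⟩ := H Finset.univ
    exact ⟨x, hx, fun i => h i (Finset.mem_univ i)⟩
  intro J
  induction J using Finset.induction_on with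
  | empty => exact ⟨hne.some, hne.some_mem, by simp⟩
  | insert k J _ ih =>
    obtain ⟨x, hx, h⟩ := ih
    by_cases hk : k ∈ tightRows M b S
    · refine ⟨x, hx, fun i hi hi' => h i ?_ hi'⟩
      exact (Finset.mem_insert.mp hi).resolve_left fun e => hi' (e ▸ hk)
    · rw [mem_tightRows] at hk
      push Not at hk
      obtain ⟨y, hy, hyk⟩ := hk
      refine ⟨(1 / 2 : ℝ) • x + (1 / 2 : ℝ) • y,
        hS hx hy (by norm_num) (by norm_num) (by norm_num), fun i hi hi' => ?_⟩
      simp only [Matrix.mulVec_add, Matrix.mulVec_smul, Pi.add_apply, Pi.smul_apply, smul_eq_mul]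
      have h1 := hSQ hx i
      have h2 := hSQ hy i
      rcases Finset.mem_insert.mp hi with rfl | hi
      · have := lt_of_le_of_ne h2 hyk
        linarith
      · have := h i hi hi'
        linarith

theorem exists_small_step {I : Finset (Fin m)} {x d : Fin n → ℝ} (hx : x ∈ polyhedron M b)
    (hI : ∀ i ∉ I, (realMat M *ᵥ x) i < b i) (hd : ∀ i ∈ I, (realMat M *ᵥ d) i ≤ 0) :
    ∃ ε : ℝ, 0 < ε ∧ x + ε • d ∈ polyhedron M b ∧
      ∀ i ∉ I, (realMat M *ᵥ (x + ε • d)) i < b i := by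
  have key : ∀ᶠ ε : ℝ in nhdsWithin 0 (Set.Ioi 0), ∀ i, i ∉ I →
      (realMat M *ᵥ (x + ε • d)) i < b i := by
    rw [Filter.eventually_all]
    intro i
    by_cases hi : i ∈ I
    · simp [hi]
    · have hc : Continuous fun ε : ℝ => (realMat M *ᵥ (x + ε • d)) i := by
        simp only [Matrix.mulVec_add, Matrix.mulVec_smul, Pi.add_apply, Pi.smul_apply]
        fun_prop
      refine ((hc.tendsto 0).eventually_lt_const (by simpa using hI i hi)).filter_mono
        nhdsWithin_le_nhds |>.mono fun ε h _ => h
  obtain ⟨ε, h, hε⟩ := (key.and self_mem_nhdsWithin).exists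
  refine ⟨ε, hε, fun i => ?_, h⟩
  by_cases hi : i ∈ I
  · simp only [Matrix.mulVec_add, Matrix.mulVec_smul, Pi.add_apply, Pi.smul_apply, smul_eq_mul]
    have := mul_nonpos_of_nonneg_of_nonpos (le_of_lt hε) (hd i hi)
    linarith [hx i]
  · exact (h i hi).le

theorem mem_face_tightRows {S : Set (Fin n → ℝ)} (hS : S ⊆ polyhedron M b) :
    S ⊆ face M b (tightRows M b S) := fun x hx =>
  ⟨hS hx, fun _ hi => mem_tightRows.mp hi x hx⟩

/-! ### Strict complementarity and optimal faces -/

/-- Farkas' lemma for the rows of `M` with index in `I`. -/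
theorem exists_conic_of_forall_le {I : Finset (Fin m)} {v : Fin n → ℝ}
    (h : ∀ d, (∀ i ∈ I, (realMat M *ᵥ d) i ≤ 0) → v ⬝ᵥ d ≤ 0) :
    ∃ y : Fin m → ℝ, (∀ i, 0 ≤ y i) ∧ (∀ i ∉ I, y i = 0) ∧ (realMat M)ᵀ *ᵥ y = v := by
  obtain ⟨y, hy0, hyI, hy⟩ := farkas I (realMat M) v h
  exact ⟨y, hy0, hyI, by rw [hy, transpose_mulVec_eq_sum_rows hyI]⟩

/-- **Strict complementarity.** An admissible objective is a conic combination of the rows that are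
tight on the optimal face, with all these multipliers positive. -/
theorem Admissible.exists_strict_dual (hw : Admissible M b w) :
    ∃ y : Fin m → ℝ, (∀ i ∈ tightRows M b (primalOpt M b w), 0 < y i) ∧
      (∀ i ∉ tightRows M b (primalOpt M b w), y i = 0) ∧ (realMat M)ᵀ *ᵥ y = w := by
  classical
  set I := tightRows M b (primalOpt M b w)
  obtain ⟨x, hx, hxI⟩ := exists_strict_of_convex convex_primalOpt (fun _ h => h.1) hw
  -- The point x can move a little along d. Optimality bounds w ⬝ᵥ d, and if this is zero the moved
  -- point is optimal too, so the rows of I stay tight.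
  have hstep : ∀ d, (∀ i ∈ I, (realMat M *ᵥ d) i ≤ 0) →
      w ⬝ᵥ d ≤ 0 ∧ (w ⬝ᵥ d = 0 → ∀ i ∈ I, (realMat M *ᵥ d) i = 0) := by
    intro d hd
    obtain ⟨ε, hε, hmem, -⟩ := exists_small_step hx.1 hxI hd
    have h1 := hx.2 _ hmem
    rw [dotProduct_add, dotProduct_smul, smul_eq_mul] at h1
    refine ⟨by nlinarith, fun h0 i hi => ?_⟩
    have hopt : x + ε • d ∈ primalOpt M b w :=
      ⟨hmem, fun z hz => by simpa [dotProduct_add, h0] using hx.2 z hz⟩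
    have h2 := mem_tightRows.mp hi _ hopt
    have h3 := mem_tightRows.mp hi _ hx
    simp only [Matrix.mulVec_add, Matrix.mulVec_smul, Pi.add_apply, Pi.smul_apply, smul_eq_mul,
      h3, add_eq_left, mul_eq_zero, hε.ne', false_or] at h2
    exact h2
  obtain ⟨y, hy0, hyI, hyw⟩ := exists_conic_of_forall_le fun d hd => (hstep d hd).1
  -- a dual solution that is positive at a given tight row
  have hpos : ∀ k, ∃ y : Fin m → ℝ, (∀ i, 0 ≤ y i) ∧ (∀ i ∉ I, y i = 0) ∧
      (realMat M)ᵀ *ᵥ y = w ∧ (k ∈ I → 0 < y k) := by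
    intro k
    by_cases hk : k ∈ I
    swap
    · exact ⟨y, hy0, hyI, hyw, fun h => absurd h hk⟩
    -- Farkas with generators -w and the rows of I gives t w = row k + ∑ cᵢ rowᵢ. As t may be 0, the
    -- representation y of w is added before dividing by 1 + t.
    obtain ⟨c, hc0, hcI, hc⟩ := farkas (Finset.insertNone I)
      (fun o => o.elim (-w) (realMat M)) (-(realMat M k)) (by
        intro d hd
        have hdI : ∀ i ∈ I, (realMat M *ᵥ d) i ≤ 0 := fun i hi =>
          hd (some i) (by simpa using hi)
        have h1 : (-w) ⬝ᵥ d ≤ 0 := hd none (by simp)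
        rw [neg_dotProduct] at h1 ⊢
        have h2 := (hstep d hdI).2 (le_antisymm (hstep d hdI).1 (by linarith)) k hk
        exact (neg_eq_zero.mpr h2).le)
    rw [Finset.sum_insertNone] at hc
    set t := c none
    have ht : 0 ≤ t := hc0 none
    have ht1 : 0 < 1 + t := by linarith
    refine ⟨fun i => (1 + t)⁻¹ * (y i + c (some i) + (Pi.single k 1 : Fin m → ℝ) i),
      fun i => ?_, fun i hi => ?_, ?_, fun _ => ?_⟩
    · have h1 : 0 ≤ (Pi.single k 1 : Fin m → ℝ) i := by
        rw [Pi.single_apply]; split_ifs <;> norm_num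
      have := hy0 i
      have := hc0 (some i)
      positivity
    · have hik : i ≠ k := fun e => hi (e ▸ hk)
      have := hcI (some i) (by simpa using hi)
      simp [hyI i hi, this, hik]
    · have hcs : (realMat M)ᵀ *ᵥ (fun i => c (some i)) = ∑ i ∈ I, c (some i) • realMat M i :=
        transpose_mulVec_eq_sum_rows fun i hi => hcI (some i) (by simpa using hi)
      have h2 : (fun i => (1 + t)⁻¹ * (y i + c (some i) + (Pi.single k 1 : Fin m → ℝ) i)) =
          (1 + t)⁻¹ • (y + (fun i => c (some i)) + Pi.single k 1) := rfl
      have h3 : ∑ i ∈ I, c (some i) • realMat M i = -(realMat M k) + t • w := by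
        have h4 : -(realMat M k) = t • (-w) + ∑ i ∈ I, c (some i) • realMat M i := hc
        rw [h4, smul_neg]
        abel
      have h5 : (realMat M)ᵀ *ᵥ (Pi.single k 1) = realMat M k := by
        ext j; simp
      rw [h2, Matrix.mulVec_smul, Matrix.mulVec_add, Matrix.mulVec_add, hyw, hcs, h3, h5,
        inv_smul_eq_iff₀ ht1.ne', add_smul, one_smul]
      abel
    · have := hy0 k
      have := hc0 (some k)
      simp only [Pi.single_eq_same]
      positivity
  choose Y hY0 hYI hYw hYk using hpos
  -- The average of the m solutions is positive on all of I; it needs m ≠ 0.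
  rcases Nat.eq_zero_or_pos m with rfl | hm
  · exact ⟨y, fun i => i.elim0, fun i => i.elim0, hyw⟩
  have hm' : (0 : ℝ) < m := by exact_mod_cast hm
  refine ⟨(m : ℝ)⁻¹ • ∑ k, Y k, fun i hi => ?_, fun i hi => ?_, ?_⟩
  · simp only [Pi.smul_apply, Finset.sum_apply, smul_eq_mul]
    exact mul_pos (inv_pos.mpr hm')
      (Finset.sum_pos' (fun k _ => hY0 k i) ⟨i, Finset.mem_univ i, hYk i hi⟩)
  · simp [hYI _ i hi]
  · rw [Matrix.mulVec_smul, Matrix.mulVec_sum, Finset.sum_congr rfl fun k _ => hYw k]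
    ext j
    simp [hm'.ne']

/-- Pairing w with x gives at most ∑ yᵢbᵢ on the polyhedron; as y is positive on I, equality forces
every row of I to be tight. -/
theorem primalOpt_eq_face {I : Finset (Fin m)} {y : Fin m → ℝ} (hne : (face M b I).Nonempty)
    (hy : ∀ i ∈ I, 0 < y i) (hyI : ∀ i ∉ I, y i = 0) (hyw : (realMat M)ᵀ *ᵥ y = w) :
    primalOpt M b w = face M b I := by
  have hy0 : ∀ i, 0 ≤ y i := fun i => by
    by_cases hi : i ∈ I
    exacts [(hy i hi).le, (hyI i hi).ge]
  have hle : ∀ x ∈ polyhedron M b, w ⬝ᵥ x ≤ ∑ i, y i * b i := fun x hx => by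
    rw [← hyw, transpose_mulVec_dotProduct]
    exact Finset.sum_le_sum fun i _ => mul_le_mul_of_nonneg_left (hx i) (hy0 i)
  have heq : ∀ x ∈ face M b I, w ⬝ᵥ x = ∑ i, y i * b i := fun x hx => by
    rw [← hyw, transpose_mulVec_dotProduct]
    refine Finset.sum_congr rfl fun i _ => ?_
    by_cases hi : i ∈ I
    · rw [hx.2 i hi]
    · rw [hyI i hi, zero_mul, zero_mul]
  obtain ⟨x₀, hx₀⟩ := hne
  ext x
  refine ⟨fun hx => ⟨hx.1, fun i hi => ?_⟩, fun hx => ⟨hx.1, fun z hz => ?_⟩⟩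
  · have h1 := heq x₀ hx₀ ▸ hx.2 x₀ hx₀.1
    have h2 : ∑ i, y i * b i = ∑ i, y i * (realMat M *ᵥ x) i := by
      rw [← transpose_mulVec_dotProduct, hyw]
      exact le_antisymm h1 (hle x hx.1)
    have h3 := (Finset.sum_eq_sum_iff_of_le fun i _ =>
      mul_le_mul_of_nonneg_left (hx.1 i) (hy0 i)).mp h2.symm i (Finset.mem_univ i)
    exact mul_left_cancel₀ (hy i hi).ne' h3
  · rw [heq x hx]
    exact hle z hz

theorem Admissible.primalOpt_eq_face_tightRows (hw : Admissible M b w) :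
    primalOpt M b w = face M b (tightRows M b (primalOpt M b w)) := by
  obtain ⟨y, hy, hyI, hyw⟩ := hw.exists_strict_dual
  exact primalOpt_eq_face (hw.mono (mem_face_tightRows fun _ h => h.1)) hy hyI hyw

theorem tightRows_face {I : Finset (Fin m)} {x : Fin n → ℝ} (hx : x ∈ face M b I)
    (hxI : ∀ i ∉ I, (realMat M *ᵥ x) i < b i) : tightRows M b (face M b I) = I := by
  ext i
  refine ⟨fun hi => ?_, fun hi => mem_tightRows.mpr fun z hz => hz.2 i hi⟩
  by_contra h
  exact (hxI i h).ne (mem_tightRows.mp hi x hx)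

/-- The slack at x off I leaves room to move along every kernel direction. -/
theorem direction_affineSpan_face {I : Finset (Fin m)} {x : Fin n → ℝ} (hx : x ∈ face M b I)
    (hxI : ∀ i ∉ I, (realMat M *ᵥ x) i < b i) :
    (affineSpan ℝ (face M b I)).direction = rowKer M I := by
  rw [direction_affineSpan]
  refine le_antisymm (Submodule.span_le.mpr ?_) fun d hd => ?_
  · rintro _ ⟨p, hp, q, hq, rfl⟩ i hi
    simp [Matrix.mulVec_sub, hp.2 i hi, hq.2 i hi]
  · obtain ⟨ε, hε, hmem, -⟩ := exists_small_step hx.1 hxI fun i hi => (hd i hi).le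
    have h1 : x + ε • d ∈ face M b I := ⟨hmem, fun i hi => by
      simp [Matrix.mulVec_add, Matrix.mulVec_smul, hx.2 i hi, hd i hi]⟩
    have h2 := vsub_mem_vectorSpan ℝ h1 hx
    rw [vsub_eq_sub, add_sub_cancel_left] at h2
    simpa [smul_smul, hε.ne'] using Submodule.smul_mem _ ε⁻¹ h2

theorem isExposed_primalOpt : IsExposed ℝ (polyhedron M b) (primalOpt M b w) := fun _ =>
  ⟨LinearMap.toContinuousLinearMap (dotProductBilin ℝ ℝ w), rfl⟩

/-! ### Complementary slackness -/

theorem Admissible.mem_dualOpt (hw : Admissible M b w) {y : Fin m → ℝ} (hy : ∀ i, 0 ≤ y i)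
    (hyI : ∀ i ∉ tightRows M b (primalOpt M b w), y i = 0) (hyw : (realMat M)ᵀ *ᵥ y = w) :
    y ∈ dualOpt M b w := by
  obtain ⟨x, hx⟩ := id hw
  refine ⟨⟨hyw, hy⟩, fun z hz => ?_⟩
  calc ∑ i, (b i : ℝ) * y i = w ⬝ᵥ x := by
        rw [← hyw, transpose_mulVec_dotProduct]
        refine Finset.sum_congr rfl fun i _ => ?_
        by_cases hi : i ∈ tightRows M b (primalOpt M b w)
        · rw [mem_tightRows.mp hi x hx, mul_comm]
        · rw [hyI i hi, zero_mul, mul_zero]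
    _ ≤ ∑ i, (b i : ℝ) * z i := by
        rw [← hz.1, transpose_mulVec_dotProduct]
        refine Finset.sum_le_sum fun i _ => ?_
        rw [mul_comm]
        exact mul_le_mul_of_nonneg_right (hx.1 i) (hz.2 i)

/-- Complementary slackness: an optimal dual solution vanishes off the rows that are tight on the
optimal face. -/
theorem Admissible.eq_zero_of_mem_dualOpt (hw : Admissible M b w) {y : Fin m → ℝ}
    (hy : y ∈ dualOpt M b w) : ∀ i ∉ tightRows M b (primalOpt M b w), y i = 0 := by
  obtain ⟨z, hz, hzI, hzw⟩ := hw.exists_strict_dual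
  have hz0 : ∀ i, 0 ≤ z i := fun i => by
    by_cases hi : i ∈ tightRows M b (primalOpt M b w)
    exacts [(hz i hi).le, (hzI i hi).ge]
  intro i hi
  rw [mem_tightRows] at hi
  push Not at hi
  obtain ⟨x, hx, hxi⟩ := hi
  have h1 : ∑ i, (b i : ℝ) * y i ≤ ∑ i, (b i : ℝ) * z i := hy.2 z ⟨hzw, hz0⟩
  have h2 : ∑ i, (b i : ℝ) * z i = w ⬝ᵥ x := by
    rw [← hzw, transpose_mulVec_dotProduct]
    refine Finset.sum_congr rfl fun i _ => ?_
    by_cases hi : i ∈ tightRows M b (primalOpt M b w)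
    · rw [mem_tightRows.mp hi x hx, mul_comm]
    · rw [hzI i hi, zero_mul, mul_zero]
  rw [h2, ← hy.1.1, transpose_mulVec_dotProduct] at h1
  have hle : ∀ i ∈ Finset.univ, y i * (realMat M *ᵥ x) i ≤ b i * y i := fun i _ => by
    rw [mul_comm]
    exact mul_le_mul_of_nonneg_right (hx.1 i) (hy.1.2 i)
  have h3 := (Finset.sum_eq_sum_iff_of_le hle).mp
    (le_antisymm (Finset.sum_le_sum hle) h1) i (Finset.mem_univ i)
  by_contra hyi
  exact hxi (mul_left_cancel₀ hyi (h3.trans (mul_comm _ _)))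

theorem mulVec_eq_of_mem_affineSpan {S : Set (Fin n → ℝ)} {x : Fin n → ℝ}
    (hx : x ∈ affineSpan ℝ S) {i : Fin m} (hi : i ∈ tightRows M b S) :
    (realMat M *ᵥ x) i = b i := by
  refine affineSpan_induction (p := fun x => (realMat M *ᵥ x) i = b i) hx
    (fun x hx => mem_tightRows.mp hi x hx) fun c u v z hu hv hz => ?_
  simp [Matrix.mulVec_add, Matrix.mulVec_smul, Matrix.mulVec_sub, hu, hv, hz]

theorem IsHeavy.transpose_mulVec_mem (hL : IsHeavy L) {y : Fin m → ℝ} (hy : ∀ i, y i ∈ L)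
    (j : Fin n) : ((realMat M)ᵀ *ᵥ y) j ∈ L := by
  obtain ⟨G, rfl⟩ := hL.subgroup
  rw [transpose_mulVec_apply]
  refine G.sum_mem fun i _ => ?_
  rw [← zsmul_eq_mul]
  exact G.zsmul_mem (hy i) _

/-! ### Down-faces -/

/-- A vector orthogonal to the kernel of the rows in `K` is a linear combination of these rows. -/
theorem exists_linear_combination_of_rowKer {K : Finset (Fin m)} {v : Fin n → ℝ}
    (h : ∀ d ∈ rowKer M K, v ⬝ᵥ d = 0) :
    ∃ z : Fin m → ℝ, (∀ i ∉ K, z i = 0) ∧ (realMat M)ᵀ *ᵥ z = v := by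
  -- Taking each row with both signs turns conic combinations into linear ones.
  obtain ⟨y, -, hyK, hy⟩ := farkas (K.disjSum K) (Sum.elim (realMat M) (-(realMat M))) v (by
    intro d hd
    refine (h d fun i hi => le_antisymm (hd (Sum.inl i) (by simpa using hi)) ?_).le
    have : (-(realMat M i)) ⬝ᵥ d ≤ 0 := hd (Sum.inr i) (by simpa using hi)
    rw [neg_dotProduct] at this
    exact neg_nonpos.mp this)
  have hz : ∀ i ∉ K, y (Sum.inl i) - y (Sum.inr i) = 0 := fun i hi => by
    rw [hyK _ (by simpa using hi), hyK _ (by simpa using hi), sub_zero]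
  refine ⟨fun i => y (Sum.inl i) - y (Sum.inr i), hz, ?_⟩
  rw [transpose_mulVec_eq_sum_rows hz, hy, Finset.sum_disjSum, ← Finset.sum_add_distrib]
  refine Finset.sum_congr rfl fun i _ => ?_
  rw [sub_smul, sub_eq_add_neg, ← smul_neg]
  rfl

/-- An optimal face other than the whole polyhedron has a down-face, given by a subset of its tight
rows. -/
theorem Admissible.exists_downFace (hw : Admissible M b w)
    (hne : primalOpt M b w ≠ polyhedron M b) :
    ∃ K ⊂ tightRows M b (primalOpt M b w), ∃ x ∈ face M b K,
      (∀ i ∉ K, (realMat M *ᵥ x) i < b i) ∧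
        IsDownFace (polyhedron M b) (primalOpt M b w) (face M b K) := by
  classical
  set I := tightRows M b (primalOpt M b w)
  have hF : primalOpt M b w = face M b I := hw.primalOpt_eq_face_tightRows
  obtain ⟨x, hx, hxI⟩ := exists_strict_of_convex convex_primalOpt (fun _ h => h.1) hw
  have hxF : x ∈ face M b I := hF ▸ hx
  obtain ⟨z, hz, hzF⟩ := Set.exists_of_ssubset
    (lt_of_le_of_ne (fun _ h => h.1 : primalOpt M b w ⊆ polyhedron M b) hne)
  have hz' : ∃ i ∈ I, (realMat M *ᵥ z) i ≠ b i := by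
    by_contra! h
    exact hzF (hF ▸ ⟨hz, h⟩)
  -- `P` describes the rows of I that stay tight along a feasible direction leaving the face. A
  -- largest such set K gives a down-face: the fewest constraints are relaxed.
  let P : Finset (Fin m) → Prop := fun K => ∃ d, (∀ i ∈ I, (realMat M *ᵥ d) i ≤ 0) ∧
    K = I.filter (fun i => (realMat M *ᵥ d) i = 0) ∧ K ≠ I
  have hP : ∃ K, P K := by
    obtain ⟨i, hi, hiz⟩ := hz'
    refine ⟨_, z - x, fun k hk => ?_, rfl, fun h => ?_⟩
    · simpa [Matrix.mulVec_sub, hxF.2 k hk] using hz k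
    · have := (Finset.mem_filter.mp (h ▸ hi)).2
      rw [Matrix.mulVec_sub, Pi.sub_apply, hxF.2 i hi, sub_eq_zero] at this
      exact hiz this
  obtain ⟨K, hK, hmax⟩ := (Finset.univ.filter P).exists_max_image Finset.card
    (by obtain ⟨K, hK⟩ := hP; exact ⟨K, by simpa using hK⟩)
  obtain ⟨d, hd, hKd, hKI⟩ := (Finset.mem_filter.mp hK).2
  have hKsub : K ⊂ I := lt_of_le_of_ne (hKd ▸ Finset.filter_subset _ _) hKI
  have hdK : d ∈ rowKer M K := fun i hi => by
    rw [hKd] at hi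
    exact (Finset.mem_filter.mp hi).2
  have hdneg : ∀ i ∈ I, i ∉ K → (realMat M *ᵥ d) i < 0 := fun i hi hiK =>
    lt_of_le_of_ne (hd i hi) fun h => hiK (hKd ▸ Finset.mem_filter.mpr ⟨hi, h⟩)
  obtain ⟨k, hkI, hkK⟩ := Finset.exists_of_ssubset hKsub
  obtain ⟨ε, hε, hmem, hstrict⟩ := exists_small_step hx.1 hxI hd
  have hx1 : x + ε • d ∈ face M b K := ⟨hmem, fun i hi => by
    simp [Matrix.mulVec_add, Matrix.mulVec_smul, hxF.2 i (hKsub.1 hi), hdK i hi]⟩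
  have hx1s : ∀ i ∉ K, (realMat M *ᵥ (x + ε • d)) i < b i := fun i hi => by
    by_cases hiI : i ∈ I
    · have := mul_neg_of_pos_of_neg hε (hdneg i hiI hi)
      simpa [Matrix.mulVec_add, Matrix.mulVec_smul, hxF.2 i hiI] using this
    · exact hstrict i hiI
  have hdI : d ∉ rowKer M I := fun h => (hdneg k hkI hkK).ne (h k hkI)
  have hsup : rowKer M K = rowKer M I ⊔ Submodule.span ℝ {d} := by
    refine le_antisymm (fun q hq => ?_) (sup_le (fun q hq i hi => hq i (hKsub.1 hi)) ?_)
    -- Ratio test: with the least ratio t, q - t d still satisfies all inequalities of I and one row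
    -- beyond K vanishes on it. Maximality of K then puts it in `rowKer M I`, so the dimension grows
    -- by exactly one.
    · obtain ⟨i₀, hi₀, hmin⟩ := (I \ K).exists_min_image
        (fun i => (realMat M *ᵥ q) i / (realMat M *ᵥ d) i)
        ⟨k, Finset.mem_sdiff.mpr ⟨hkI, hkK⟩⟩
      rw [Finset.mem_sdiff] at hi₀
      set t := (realMat M *ᵥ q) i₀ / (realMat M *ᵥ d) i₀
      have hmul : ∀ i, (realMat M *ᵥ (q - t • d)) i =
          (realMat M *ᵥ q) i - t * (realMat M *ᵥ d) i := fun i => by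
        simp [Matrix.mulVec_sub, Matrix.mulVec_smul]
      have h0 : ∀ i ∈ K, (realMat M *ᵥ (q - t • d)) i = 0 := fun i hi => by
        rw [hmul, hq i hi, hdK i hi, mul_zero, sub_zero]
      have h1 : (realMat M *ᵥ (q - t • d)) i₀ = 0 := by
        rw [hmul, div_mul_cancel₀ _ (hdneg i₀ hi₀.1 hi₀.2).ne, sub_self]
      have hle : ∀ i ∈ I, (realMat M *ᵥ (q - t • d)) i ≤ 0 := fun i hi => by
        by_cases hiK : i ∈ K
        · exact (h0 i hiK).le
        · rw [hmul, sub_nonpos]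
          exact (le_div_iff_of_neg (hdneg i hi hiK)).mp
            (hmin i (Finset.mem_sdiff.mpr ⟨hi, hiK⟩))
      have hker : q - t • d ∈ rowKer M I := by
        by_contra hnot
        have hPK : P (I.filter fun i => (realMat M *ᵥ (q - t • d)) i = 0) :=
          ⟨_, hle, rfl, fun h => hnot fun i hi => Finset.filter_eq_self.mp h i hi⟩
        refine absurd (hmax _ (Finset.mem_filter.mpr ⟨Finset.mem_univ _, hPK⟩)) (not_le.mpr ?_)
        refine Finset.card_lt_card (Finset.ssubset_iff_of_subset (fun i hi => ?_) |>.mpr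
          ⟨i₀, Finset.mem_filter.mpr ⟨hi₀.1, h1⟩, hi₀.2⟩)
        exact Finset.mem_filter.mpr ⟨hKsub.1 hi, h0 i hi⟩
      rw [← sub_add_cancel q (t • d)]
      exact Submodule.add_mem_sup hker (Submodule.smul_mem _ _ (Submodule.mem_span_singleton_self d))
    · rw [Submodule.span_singleton_le_iff_mem]
      exact hdK
  have hd0 : d ≠ 0 := fun h => hdI (h ▸ Submodule.zero_mem _)
  have hfin : Module.finrank ℝ (rowKer M K) = Module.finrank ℝ (rowKer M I) + 1 := by
    have h1 := Submodule.finrank_sup_add_finrank_inf_eq (rowKer M I) (Submodule.span ℝ {d})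
    rw [← hsup, (Submodule.disjoint_span_singleton' hd0).mpr hdI |>.eq_bot, finrank_bot,
      finrank_span_singleton hd0] at h1
    simpa using h1
  have hexp : IsExposed ℝ (polyhedron M b) (face M b K) := by
    -- The sum of the rows of K exposes the face.
    have h := primalOpt_eq_face
      (y := fun i => if i ∈ K then 1 else 0) ⟨x + ε • d, hx1⟩
      (fun i hi => by simp [hi]) (fun i hi => by simp [hi]) rfl
    rw [← h]
    exact isExposed_primalOpt
  refine ⟨K, hKsub, x + ε • d, hx1, hx1s, hw, isExposed_primalOpt, hexp, ?_, ?_⟩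
  · rw [hF]
    have hsub : face M b I ⊆ face M b K := fun p hp => ⟨hp.1, fun i hi => hp.2 i (hKsub.1 hi)⟩
    refine (Set.ssubset_iff_of_subset hsub).mpr
      ⟨_, hx1, fun h => (hx1s k hkK).ne (h.2 k hkI)⟩
  · rw [hF, dim, dim, direction_affineSpan_face hx1 hx1s, direction_affineSpan_face hxF hxI, hfin]

/-- The objective is not constant on the affine hull of a down-face of its optimal face: it attains
the optimal value only on the affine hull of the optimal face. -/
theorem mem_affineSpan_of_dotProduct_eq {F F' : Set (Fin n → ℝ)} {τ : ℝ} (hF : F.Nonempty)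
    (hFF' : F ⊆ F') (hdim : dim F' = dim F + 1) (hFτ : ∀ x ∈ F, w ⬝ᵥ x = τ)
    (hF'τ : ∃ x ∈ F', w ⬝ᵥ x ≠ τ) {ρ : Fin n → ℝ} (hρ : ρ ∈ affineSpan ℝ F')
    (hρτ : w ⬝ᵥ ρ = τ) : ρ ∈ affineSpan ℝ F := by
  obtain ⟨p, hp⟩ := hF
  obtain ⟨q, hq, hqτ⟩ := hF'τ
  have hle : affineSpan ℝ F ≤ affineSpan ℝ F' := affineSpan_mono ℝ hFF'
  have hpF := subset_affineSpan ℝ F hp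
  set D := (affineSpan ℝ F).direction with hD
  set D' := (affineSpan ℝ F').direction
  let W : Submodule ℝ (Fin n → ℝ) := LinearMap.ker (dotProductBilin ℝ ℝ w)
  have hDW : D ≤ D' ⊓ W := by
    refine le_inf (AffineSubspace.direction_le hle) ?_
    rw [hD, direction_affineSpan]
    refine Submodule.span_le.mpr ?_
    rintro _ ⟨a, ha, c, hc, rfl⟩
    change w ⬝ᵥ (a - c) = 0
    rw [dotProduct_sub, hFτ a ha, hFτ c hc, sub_self]
  have hlt : D' ⊓ W < D' := by
    refine lt_of_le_of_ne inf_le_left fun h => hqτ ?_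
    have h1 : q -ᵥ p ∈ D' := AffineSubspace.vsub_mem_direction (subset_affineSpan ℝ F' hq) (hle hpF)
    rw [← h] at h1
    have h2 : w ⬝ᵥ (q - p) = 0 := h1.2
    rw [dotProduct_sub, hFτ p hp, sub_eq_zero] at h2
    exact h2
  -- D lies in D' ⊓ W, which is a proper subspace of D', and D' has only one dimension more than D.
  have heq : D = D' ⊓ W := by
    refine Submodule.eq_of_le_of_finrank_le hDW ?_
    have h1 : Module.finrank ℝ D' = Module.finrank ℝ D + 1 := hdim
    have h2 := Submodule.finrank_lt_finrank_of_lt hlt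
    omega
  have hmem : ρ -ᵥ p ∈ D := by
    rw [heq]
    refine ⟨AffineSubspace.vsub_mem_direction hρ (hle hpF), ?_⟩
    change w ⬝ᵥ (ρ - p) = 0
    rw [dotProduct_sub, hFτ p hp, hρτ, sub_self]
  rw [← vsub_vadd ρ p]
  exact AffineSubspace.vadd_mem_of_mem_direction hmem hpF

/-! ### Necessity of the two conditions -/

/-- A combination of implicit equalities is constant on the polyhedron, so its optimal face is
everything and an optimal dual solution uses only those rows. -/
theorem IsTotallyDual.rowsFormGSC (h : IsTotallyDual L M b)
    (hQ : (polyhedron M b).Nonempty) : RowsFormGSC L (implicitEqMatrix M b) := by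
  classical
  rintro v hv ⟨c, -, hvc⟩
  let I := tightRows M b (polyhedron M b)
  let y : Fin m → ℝ := fun i => if hi : i ∈ I then c ⟨i, hi⟩ else 0
  have key : ∀ z : Fin m → ℝ, (∀ i ∉ I, z i = 0) →
      (realMat M)ᵀ *ᵥ z = ∑ i : {i // i ∈ I}, z i.1 • (fun j => (implicitEqMatrix M b i j : ℝ)) :=
    fun z hz => by
      rw [transpose_mulVec_eq_sum_rows hz, ← Finset.sum_coe_sort]
      rfl
  have hyI : ∀ i ∉ I, y i = 0 := fun i hi => dif_neg hi
  have hyv : (realMat M)ᵀ *ᵥ y = v := by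
    rw [key y hyI, hvc]
    exact Finset.sum_congr rfl fun i _ => by simp [y]
  have hconst : ∀ x ∈ polyhedron M b, v ⬝ᵥ x = ∑ i, y i * b i := fun x hx => by
    rw [← hyv, transpose_mulVec_dotProduct]
    refine Finset.sum_congr rfl fun i _ => ?_
    by_cases hi : i ∈ I
    · rw [mem_tightRows.mp hi x hx]
    · rw [hyI i hi, zero_mul, zero_mul]
  have hopt : primalOpt M b v = polyhedron M b :=
    Set.Subset.antisymm (fun _ hx => hx.1) fun x hx =>
      ⟨hx, fun z hz => by rw [hconst x hx, hconst z hz]⟩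
  have hadm : Admissible M b v := by rw [Admissible, hopt]; exact hQ
  obtain ⟨z, hz, hzL⟩ := h v hv hadm
  have hzI := hadm.eq_zero_of_mem_dualOpt hz
  rw [hopt] at hzI
  exact ⟨fun i => z i.1, fun i => hz.1.2 i, fun i => hzL i, by rw [← key z hzI, hz.1.1]⟩

/-- One optimal dual solution over L solves the tilt constraints of all down-faces at once. -/
theorem IsTotallyDual.tiltSolvableIn (h : IsTotallyDual L M b) (hwL : ∀ j, w j ∈ L)
    (hw : Admissible M b w) {τ : ℝ} (hτ : IsPrimalValue M b w τ) {F' : Set (Fin n → ℝ)}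
    (hF' : IsDownFace (polyhedron M b) (primalOpt M b w) F') :
    TiltSolvableIn L M b w τ (primalOpt M b w) F' := by
  classical
  obtain ⟨y, hy, hyL⟩ := h w hwL hw
  have hyI := hw.eq_zero_of_mem_dualOpt hy
  obtain ⟨-, -, hexp, hss, hdim⟩ := hF'
  have hFτ : ∀ x ∈ primalOpt M b w, w ⬝ᵥ x = τ := fun x hx => by
    obtain ⟨⟨z, hz, rfl⟩, hub⟩ := hτ
    exact le_antisymm (hub ⟨x, hx.1, rfl⟩) (hx.2 z hz)
  refine ⟨y, fun i _ => hyL i, fun ρ hρ hρF => ?_⟩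
  have hne : w ⬝ᵥ ρ ≠ τ := fun hρτ => by
    refine hρF (mem_affineSpan_of_dotProduct_eq hw hss.1 hdim hFτ ?_ hρ hρτ)
    obtain ⟨q, hq, hqF⟩ := Set.exists_of_ssubset hss
    have hsub : F' ⊆ polyhedron M b := hexp.subset
    refine ⟨q, hq, fun hqτ => hqF ⟨hsub hq, fun z hz => ?_⟩⟩
    rw [hqτ]
    exact hτ.2 ⟨z, hz, rfl⟩
  obtain ⟨p, hp⟩ := id hw
  have hsum : ∑ i ∈ tightRows M b (primalOpt M b w) \ tightRows M b F',
      ((b i : ℝ) - (realMat M *ᵥ ρ) i) * y i = τ - w ⬝ᵥ ρ := by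
    rw [Finset.sum_subset (Finset.subset_univ _), ← hFτ p hp, ← hy.1.1,
      transpose_mulVec_dotProduct, transpose_mulVec_dotProduct, ← Finset.sum_sub_distrib]
    · refine Finset.sum_congr rfl fun i _ => ?_
      by_cases hi : i ∈ tightRows M b (primalOpt M b w)
      · rw [mem_tightRows.mp hi p hp]; ring
      · rw [hyI i hi]; ring
    · intro i _ hi
      rw [Finset.mem_sdiff, not_and_or, not_not] at hi
      rcases hi with hi | hi
      · rw [hyI i hi, mul_zero]
      · rw [mulVec_eq_of_mem_affineSpan hρ hi, sub_self, zero_mul]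
  rw [hsum, one_div, inv_mul_cancel₀ (sub_ne_zero.mpr hne.symm)]

/-! ### Sufficiency of the two conditions -/

/-- Under the generating-set and tilt conditions, every admissible objective over `L` is an
`L`-combination (with multipliers of any sign) of the rows that are tight on its optimal face. -/
theorem exists_combination_of_tilt (hL : IsHeavy L)
    (hgen : RowsFormGSC L (implicitEqMatrix M b))
    (htilt : ∀ w : Fin n → ℝ, (∀ j, w j ∈ L) → Admissible M b w →
      ∀ τ : ℝ, IsPrimalValue M b w τ → ∀ F' : Set (Fin n → ℝ),
        IsDownFace (polyhedron M b) (primalOpt M b w) F' →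
          TiltSolvableIn L M b w τ (primalOpt M b w) F')
    (k : ℕ) (w : Fin n → ℝ) (hwL : ∀ j, w j ∈ L) (hw : Admissible M b w)
    (hk : (tightRows M b (primalOpt M b w)).card = k) :
    ∃ y : Fin m → ℝ, (∀ i, y i ∈ L) ∧ (∀ i ∉ tightRows M b (primalOpt M b w), y i = 0) ∧
      (realMat M)ᵀ *ᵥ y = w := by
  classical
  have h0L : (0 : ℝ) ∈ L := by exact_mod_cast hL.int_mem 0
  induction k using Nat.strong_induction_on generalizing w with
  | _ k ih =>
  by_cases hwQ : primalOpt M b w = polyhedron M b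
  · obtain ⟨z, hz, hzI, hzw⟩ := hw.exists_strict_dual
    rw [hwQ] at hz hzI ⊢
    have key : ∀ z : Fin m → ℝ, (∀ i ∉ tightRows M b (polyhedron M b), z i = 0) →
        (realMat M)ᵀ *ᵥ z = ∑ i : {i // i ∈ tightRows M b (polyhedron M b)},
          z i.1 • (fun j => (implicitEqMatrix M b i j : ℝ)) := fun z hz => by
      rw [transpose_mulVec_eq_sum_rows hz, ← Finset.sum_coe_sort]
      rfl
    obtain ⟨c, -, hcL, hc⟩ := hgen w hwL
      ⟨fun i => z i.1, fun i => (hz i.1 i.2).le, by rw [← key z hzI, hzw]⟩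
    refine ⟨fun i => if hi : i ∈ tightRows M b (polyhedron M b) then c ⟨i, hi⟩ else 0,
      fun i => ?_, fun i hi => dif_neg hi, ?_⟩
    · beta_reduce
      split_ifs
      exacts [hcL _, h0L]
    · rw [key _ fun i hi => dif_neg hi, hc]
      exact Finset.sum_congr rfl fun i _ => by simp
  · obtain ⟨K, hKI, x, hx, hxK, hdown⟩ := hw.exists_downFace hwQ
    set I := tightRows M b (primalOpt M b w)
    have hKt : tightRows M b (face M b K) = K := tightRows_face hx hxK
    obtain ⟨p, hp⟩ := id hw
    obtain ⟨u, huL, hu⟩ := htilt w hwL hw (w ⬝ᵥ p)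
      ⟨⟨p, hp.1, rfl⟩, by rintro _ ⟨z, hz, rfl⟩; exact hp.2 z hz⟩ _ hdown
    rw [hKt] at huL
    obtain ⟨k₀, hk₀I, hk₀K⟩ := Finset.exists_of_ssubset hKI
    let u' : Fin m → ℝ := fun i => if i ∈ I \ K then u i else 0
    have hu'L : ∀ i, u' i ∈ L := fun i => by
      simp only [u']
      split_ifs with hi
      exacts [huL i hi, h0L]
    have hu'I : ∀ i ∉ I, u' i = 0 := fun i hi => by simp [u', hi]
    set w' : Fin n → ℝ := w - (realMat M)ᵀ *ᵥ u' with hw'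
    -- The tilt constraint says exactly that w' is constant on these ρ. Slack at `k₀` keeps them off
    -- the affine hull of the optimal face.
    have hval : ∀ ρ ∈ face M b K, (∀ i ∉ K, (realMat M *ᵥ ρ) i < b i) →
        w' ⬝ᵥ ρ = w ⬝ᵥ p - ∑ i ∈ I \ K, b i * u i := by
      intro ρ hρ hρK
      have h1 := hu ρ (subset_affineSpan ℝ _ hρ) fun hmem =>
        (hρK k₀ hk₀K).ne (mulVec_eq_of_mem_affineSpan hmem hk₀I)
      rw [hKt] at h1
      -- With a zero denominator, `1 / 0 = 0` would turn the constraint into 0 = 1.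
      have h2 : w ⬝ᵥ p - w ⬝ᵥ ρ ≠ 0 := fun h => by simp [h] at h1
      rw [one_div, inv_mul_eq_one₀ h2] at h1
      have h3 : ((realMat M)ᵀ *ᵥ u') ⬝ᵥ ρ = ∑ i ∈ I \ K, (realMat M *ᵥ ρ) i * u i := by
        rw [transpose_mulVec_dotProduct, ← Finset.sum_subset (Finset.subset_univ (I \ K))]
        · exact Finset.sum_congr rfl fun i hi => by simp only [u', if_pos hi]; ring
        · exact fun i _ hi => by simp only [u', if_neg hi, zero_mul]
      rw [hw', sub_dotProduct, h3]
      simp only [sub_mul, Finset.sum_sub_distrib] at h1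
      linarith
    obtain ⟨z, hzK, hz⟩ := exists_linear_combination_of_rowKer (K := K) (M := M) (v := w') (by
      intro d hd
      obtain ⟨ε, hε, hmem, hs⟩ := exists_small_step hx.1 hxK fun i hi => (hd i hi).le
      have hmem' : x + ε • d ∈ face M b K := ⟨hmem, fun i hi => by
        simp [Matrix.mulVec_add, Matrix.mulVec_smul, hx.2 i hi, hd i hi]⟩
      have h1 := (hval _ hmem' hs).trans (hval x hx hxK).symm
      simpa [dotProduct_add, hε.ne'] using h1)
    -- Adding N to each coefficient on K makes them all positive, so the optimal face becomes `face
    -- M b K`; N is an integer, so the objective stays over L and the shift can be undone there.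
    obtain ⟨N, hN⟩ := exists_nat_gt (∑ i, |z i|)
    let e : Fin m → ℝ := fun i => if i ∈ K then (N : ℝ) else 0
    have heL : ∀ i, e i ∈ L := fun i => by
      simp only [e]
      split_ifs
      exacts [by exact_mod_cast hL.int_mem N, h0L]
    have hpos : ∀ i ∈ K, 0 < (z + e) i := fun i hi => by
      have h1 : |z i| ≤ ∑ i, |z i| :=
        Finset.single_le_sum (f := fun i => |z i|) (fun i _ => abs_nonneg _) (Finset.mem_univ i)
      have h2 := neg_abs_le (z i)
      simp only [Pi.add_apply, e, if_pos hi]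
      linarith
    have hzero : ∀ i ∉ K, (z + e) i = 0 := fun i hi => by simp [e, hzK i hi, hi]
    have hopt := primalOpt_eq_face ⟨x, hx⟩ hpos hzero rfl
    have hw'' : (realMat M)ᵀ *ᵥ (z + e) = w - (realMat M)ᵀ *ᵥ u' + (realMat M)ᵀ *ᵥ e := by
      rw [Matrix.mulVec_add, hz]
    have hw''L : ∀ j, ((realMat M)ᵀ *ᵥ (z + e)) j ∈ L := fun j => by
      have h1 := hwL j
      have h2 := hL.transpose_mulVec_mem (M := M) hu'L j
      have h3 := hL.transpose_mulVec_mem (M := M) heL j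
      rw [hw'']
      obtain ⟨G, rfl⟩ := hL.subgroup
      exact G.add_mem (G.sub_mem h1 h2) h3
    obtain ⟨y, hyL, hyK, hy⟩ := ih K.card (hk ▸ Finset.card_lt_card hKI) _ hw''L
      (by rw [Admissible, hopt]; exact ⟨x, hx⟩) (by rw [hopt, hKt])
    rw [hopt, hKt] at hyK
    refine ⟨y + u' - e, fun i => ?_, fun i hi => ?_, ?_⟩
    · have h1 := hyL i
      have h2 := hu'L i
      have h3 := heL i
      obtain ⟨G, rfl⟩ := hL.subgroup
      exact G.sub_mem (G.add_mem h1 h2) h3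
    · have hiK : i ∉ K := fun h => hi (hKI.1 h)
      simp [hyK i hiK, hu'I i hi, e, hiK]
    · rw [Matrix.mulVec_sub, Matrix.mulVec_add, hy, hw'']
      abel

/-- An admissible objective that is an `L`-combination of the rows tight on its optimal face has an
optimal dual solution over `L`. -/
theorem Admissible.exists_mem_dualOpt (hL : IsHeavy L) (hw : Admissible M b w)
    {y : Fin m → ℝ} (hyL : ∀ i, y i ∈ L) (hyI : ∀ i ∉ tightRows M b (primalOpt M b w), y i = 0)
    (hyw : (realMat M)ᵀ *ᵥ y = w) : ∃ v ∈ dualOpt M b w, ∀ i, v i ∈ L := by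
  obtain ⟨z, hz, hzI, hzw⟩ := hw.exists_strict_dual
  obtain ⟨v, hvL, hv, hvI, hvw⟩ := hL.exists_pos_solution (fun j i => M i j) _ y z hyL hyI hz hzI
    fun j => by rw [← transpose_mulVec_apply, ← transpose_mulVec_apply, hyw, hzw]
  refine ⟨v, hw.mem_dualOpt (fun i => ?_) hvI ?_, hvL⟩
  · by_cases hi : i ∈ tightRows M b (primalOpt M b w)
    exacts [(hv i hi).le, (hvI i hi).ge]
  · rw [← hzw]
    exact funext hvw

end TotalDual

theorem mainTheorem1 (m n : ℕ) (M : Matrix (Fin m) (Fin n) ℤ) (b : Fin m → ℤ)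
    (L : Set ℝ) (hL : TotalDual.IsHeavy L) (hQ : (TotalDual.polyhedron M b).Nonempty) :
    TotalDual.IsTotallyDual L M b ↔
      TotalDual.RowsFormGSC L (TotalDual.implicitEqMatrix M b) ∧
      ∀ w : Fin n → ℝ, (∀ j, w j ∈ L) → TotalDual.Admissible M b w →
        ∀ τ : ℝ, TotalDual.IsPrimalValue M b w τ →
        ∀ F' : Set (Fin n → ℝ),
          TotalDual.IsDownFace (TotalDual.polyhedron M b) (TotalDual.primalOpt M b w) F' →
          TotalDual.TiltSolvableIn L M b w τ (TotalDual.primalOpt M b w) F' := by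
  refine ⟨fun h => ⟨h.rowsFormGSC hQ, fun w hwL hw τ hτ F' hF' =>
    h.tiltSolvableIn hwL hw hτ hF'⟩, fun ⟨hgen, htilt⟩ w hwL hw => ?_⟩
  obtain ⟨y, hyL, hyI, hyw⟩ :=
    TotalDual.exists_combination_of_tilt hL hgen htilt _ w hwL hw rfl
  exact hw.exists_mem_dualOpt hL hyL hyI hyw
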